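/- All graphs are finite, simple and undirected. Let $G$ be a graph and $S\subseteq V(G)$ with $|S|\ge 2$. A pendant $S$-Steiner tree of $G$ is a subgraph $T$ of $G$ that is a tree with $S\subseteq V(T)$ and in which every vertex of $S$ has degree $1$. Two such trees $T,T'$ are edge-disjoint if $E(T)\cap E(T')=\varnothing$, and internally disjoint if $E(T)\cap E(T')=\varnothing$ and $V(T)\cap V(T')=S$. Let $\tau_G(S)$ (resp. $\mu_G(S)$) be the maximum number of pairwise internally disjoint (resp. pairwise edge-disjoint) pendant $S$-Steiner trees in $G$, and put $$\tau_3(G)=\min\{\tau_G(S) : S\subseteq V(G),\ |S|=3\},\qquad \mu_3(G)=\min\{\mu_G(S) : S\subseteq V(G),\ |S|=3\},$$ with the convention $\tau_3(G)=\mu_3(G)=0$ if $G$ has fewer than three vertices. Let $L(G)$ denote the line graph of $G$. Theorem. Let $G$ be a connected graph. Then 1. $\mu_3(G)\le \tau_3(L(G))$; 2. $\mu_3(L(G))\ge \frac{1}{12}\mu_3(G)-\frac12$; 3. $\tau_3(L(L(G)))\ge \frac14\tau_3(G)-\frac23$. -/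

import Mathlib

namespace SimpleGraph

variable {V : Type*} {G : SimpleGraph V}

/-- `T` is a pendant `S`-Steiner tree of `G`: a subgraph of `G` that is a tree, contains all
vertices of `S`, and in which every vertex of `S` has degree one. -/
structure IsPendantSteinerTree (S : Finset V) (T : G.Subgraph) : Prop where
  isTree : T.coe.IsTree
  subset_verts : (S : Set V) ⊆ T.verts
  degree_eq_one : ∀ v ∈ S, (T.neighborSet v).ncard = 1

/-- Two subgraphs are internally disjoint with respect to `S` if they share no edge and share
exactly the vertices of `S`. -/
def InternallyDisjoint (S : Finset V) (T T' : G.Subgraph) : Prop :=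
  T.edgeSet ∩ T'.edgeSet = ∅ ∧ T.verts ∩ T'.verts = (S : Set V)

/-- Two subgraphs are edge-disjoint if they share no edge. -/
def EdgeDisjoint (T T' : G.Subgraph) : Prop :=
  T.edgeSet ∩ T'.edgeSet = ∅

/-- The pendant-tree local connectivity `τ_G(S)`: the maximum number of pairwise internally
disjoint pendant `S`-Steiner trees in `G` (for finite `G` the supremum is a maximum). -/
noncomputable def pendantTreeLocalConnectivity (G : SimpleGraph V) (S : Finset V) : ℕ :=
  sSup {m | ∃ F : Finset G.Subgraph, F.card = m ∧ (∀ T ∈ F, IsPendantSteinerTree S T) ∧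
    (F : Set G.Subgraph).Pairwise (InternallyDisjoint S)}

/-- The pendant-tree local edge-connectivity `μ_G(S)`: the maximum number of pairwise edge-disjoint
pendant `S`-Steiner trees in `G` (for finite `G` the supremum is a maximum). -/
noncomputable def pendantTreeLocalEdgeConnectivity (G : SimpleGraph V) (S : Finset V) : ℕ :=
  sSup {m | ∃ F : Finset G.Subgraph, F.card = m ∧ (∀ T ∈ F, IsPendantSteinerTree S T) ∧
    (F : Set G.Subgraph).Pairwise EdgeDisjoint}

/-- The pendant-tree `k`-connectivity `τ_k(G)`: the minimum of `τ_G(S)` over all `k`-element vertex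
sets `S`. If `G` has fewer than `k` vertices, the value is `0`. -/
noncomputable def pendantTreeConnectivity (G : SimpleGraph V) (k : ℕ) : ℕ :=
  sInf {m | ∃ S : Finset V, S.card = k ∧ G.pendantTreeLocalConnectivity S = m}

/-- The pendant-tree `k`-edge-connectivity `μ_k(G)`: the minimum of `μ_G(S)` over all `k`-element
vertex sets `S`. If `G` has fewer than `k` vertices, the value is `0`. -/
noncomputable def pendantTreeEdgeConnectivity (G : SimpleGraph V) (k : ℕ) : ℕ :=
  sInf {m | ∃ S : Finset V, S.card = k ∧ G.pendantTreeLocalEdgeConnectivity S = m}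

end SimpleGraph

/-!
Deleting the leaves `S` from a pendant `S`-Steiner tree of `G` leaves it connected, so the edges of
the tree induce a connected subgraph of the line graph, even after discarding some of the pendant
edges. Edge-disjoint trees thus yield disjoint connected vertex sets of `L(G)`. If every vertex of
a `k`-set `E` of edges, outside these sets, has a neighbour in each of them, then hanging `E` onto
each set gives internally disjoint pendant `E`-Steiner trees.

What remains is to choose, for a given `E`, a `k`-set `S` of vertices such that every `S`-Steiner
tree has an edge outside `E` next to each `e ∈ E`. Such a tree leaves an endpoint `x ∈ S` of `e` by
its pendant edge at `x`, which is fine unless this edge is in `E`; we choose `S` so that it must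
then be `e` itself, and walk on from the other endpoint of `e`. The only obstruction is that the
tree is a star with all its edges in `E`, and then a leaf of the star can be exchanged for its
centre. This gives `μ_k(G) ≤ τ_k(L(G))`, and the other bounds follow from `τ_k ≤ μ_k`.
-/

namespace PendantTree

open SimpleGraph
open scoped Finset

section PrivateCover

variable {V : Type*} {E : Finset (Sym2 V)} {S S' : Finset V} {u v : V}

/-- `S` is a vertex cover of the edge set `E` in which every edge `e` of `E` has a private endpoint:
one from which no edge of `E`, except possibly `e` itself, leads out of `S`. This is the weakening
of a system of distinct representatives that exists for every `E`, even if `E` has more edges than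
vertices. -/
def IsPrivateCover (E : Finset (Sym2 V)) (S : Finset V) : Prop :=
  ∀ e ∈ E, ∃ x ∈ e, x ∈ S ∧ ∀ y ∉ S, s(x, y) ∈ E → s(x, y) = e

namespace IsPrivateCover

lemma mono (hS : IsPrivateCover E S) (hSS' : S ⊆ S') : IsPrivateCover E S' := fun e he ↦
  let ⟨x, hxe, hxS, hx⟩ := hS e he
  ⟨x, hxe, hSS' hxS, fun y hy ↦ hx y fun hyS ↦ hy (hSS' hyS)⟩

lemma mk_notMem (hS : IsPrivateCover E S) (hu : u ∉ S) (hv : v ∉ S) : s(u, v) ∉ E := by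
  intro he
  obtain ⟨x, hx, hxS, -⟩ := hS _ he
  rcases Sym2.mem_iff.1 hx with rfl | rfl
  · exact hu hxS
  · exact hv hxS

lemma eq_of_mk_mem (hS : IsPrivateCover E S) {x y z : V} (hy : y ∉ S) (hz : z ∉ S)
    (hxy : s(x, y) ∈ E) (hxz : s(x, z) ∈ E) : y = z := by
  obtain ⟨w, hw, hwS, hpriv⟩ := hS _ hxz
  rcases Sym2.mem_iff.1 hw with rfl | rfl
  · exact Sym2.congr_right.1 (hpriv y hy hxy)
  · exact absurd hwS hz

variable [DecidableEq V]

lemma insert_of_notMem (hS : IsPrivateCover E S) (hu : u ∉ S) (v : V) :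
    IsPrivateCover (insert s(u, v) E) (insert u S) := by
  intro e he
  rcases Finset.mem_insert.1 he with rfl | he
  · refine ⟨u, Sym2.mem_mk_left u v, Finset.mem_insert_self u S, fun y hy hyE ↦ ?_⟩
    have hyS : y ∉ S := fun h ↦ hy (Finset.mem_insert_of_mem h)
    exact (Finset.mem_insert.1 hyE).resolve_right (hS.mk_notMem hu hyS)
  · obtain ⟨x, hxe, hxS, hpriv⟩ := hS e he
    refine ⟨x, hxe, Finset.mem_insert_of_mem hxS, fun y hy hyE ↦ ?_⟩
    simp only [Finset.mem_insert, not_or] at hy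
    have hne : s(x, y) ≠ s(u, v) := by
      intro h
      rcases Sym2.eq_iff.1 h with ⟨rfl, -⟩ | ⟨-, rfl⟩
      exacts [hu hxS, hy.1 rfl]
    exact hpriv y hy.2 ((Finset.mem_insert.1 hyE).resolve_left hne)

lemma insert_of_mem (hS : IsPrivateCover E S) (hu : u ∈ S) (hv : v ∈ S)
    (hout : ∀ y ∉ S, s(u, y) ∉ E) : IsPrivateCover (insert s(u, v) E) S := by
  intro e he
  rcases Finset.mem_insert.1 he with rfl | he
  · exact ⟨u, Sym2.mem_mk_left u v, hu, fun y hy hyE ↦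
      (Finset.mem_insert.1 hyE).resolve_right (hout y hy)⟩
  · obtain ⟨x, hxe, hxS, hpriv⟩ := hS e he
    refine ⟨x, hxe, hxS, fun y hy hyE ↦ ?_⟩
    have hne : s(x, y) ≠ s(u, v) := by
      intro h
      rcases Sym2.eq_iff.1 h with ⟨-, rfl⟩ | ⟨-, rfl⟩
      exacts [hy hv, hy hu]
    exact hpriv y hy ((Finset.mem_insert.1 hyE).resolve_left hne)

lemma exists_insert (hS : IsPrivateCover E S) (e : Sym2 V) :
    ∃ S', #S' ≤ #S + 1 ∧ IsPrivateCover (insert e E) S' := by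
  induction e with | _ u v
  by_cases hu : u ∉ S
  · exact ⟨insert u S, Finset.card_insert_le u S, hS.insert_of_notMem hu v⟩
  by_cases hv : v ∉ S
  · exact ⟨insert v S, Finset.card_insert_le v S, Sym2.eq_swap (a := u) ▸ hS.insert_of_notMem hv u⟩
  rw [not_not] at hu hv
  by_cases hout : ∀ y ∉ S, s(u, y) ∉ E
  · exact ⟨S, Nat.le_succ _, hS.insert_of_mem hu hv hout⟩
  push Not at hout
  obtain ⟨z, hz, hzE⟩ := hout
  refine ⟨insert z S, Finset.card_insert_le z S, (hS.mono (Finset.subset_insert z S)).insert_of_mem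
    (Finset.mem_insert_of_mem hu) (Finset.mem_insert_of_mem hv) fun y hy hyE ↦ ?_⟩
  simp only [Finset.mem_insert, not_or] at hy
  exact hy.1 (hS.eq_of_mk_mem hy.2 hz hyE hzE)

end IsPrivateCover

lemma exists_isPrivateCover (E : Finset (Sym2 V)) : ∃ S, #S ≤ #E ∧ IsPrivateCover E S := by
  classical
  induction E using Finset.induction_on with
  | empty => exact ⟨∅, le_rfl, fun e he ↦ absurd he (Finset.notMem_empty e)⟩
  | insert e E he ih =>
    obtain ⟨S, hcard, hS⟩ := ih
    obtain ⟨S', hcard', hS'⟩ := hS.exists_insert e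
    exact ⟨S', by rw [Finset.card_insert_of_notMem he]; lia, hS'⟩

lemma isPrivateCover_star [DecidableEq V] {a z : V} (hz : z ∉ S) :
    IsPrivateCover (S.image (s(·, z))) (insert z (S.erase a)) := by
  intro e he
  obtain ⟨b, hb, rfl⟩ := Finset.mem_image.1 he
  by_cases hba : b = a
  · refine ⟨z, Sym2.mem_mk_right b z, by simp, fun y hy hyE ↦ ?_⟩
    grind
  · refine ⟨b, Sym2.mem_mk_left b z, by simp [hb, hba], fun y hy hyE ↦ ?_⟩
    grind

lemma exists_isPrivateCover_card_eq {S₀ : Finset V} (hE : 2 ≤ #E) (hS₀ : #S₀ = #E) :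
    ∃ S, #S = #E ∧ IsPrivateCover E S ∧ ∀ z ∉ S, ∃ x ∈ S, s(x, z) ∉ E := by
  classical
  obtain ⟨S₁, hcard₁, hS₁⟩ := exists_isPrivateCover E
  obtain ⟨S, hS₁S, -, hcard⟩ := Finset.exists_subsuperset_card_eq
    (Finset.subset_union_left (s₂ := S₀)) hcard₁
    (hS₀ ▸ Finset.card_le_card Finset.subset_union_right)
  by_cases hstar : ∀ z ∉ S, ∃ x ∈ S, s(x, z) ∉ E
  · exact ⟨S, hcard, hS₁.mono hS₁S, hstar⟩
  push Not at hstar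
  obtain ⟨z, hz, hzE⟩ := hstar
  obtain rfl : S.image (s(·, z)) = E := by
    refine Finset.eq_of_subset_of_card_le (Finset.image_subset_iff.2 hzE) ?_
    rw [Finset.card_image_of_injective _ fun a b ↦ Sym2.congr_left.1, hcard]
  obtain ⟨a, ha, b, hb, hab⟩ := Finset.one_lt_card.1 (hcard ▸ hE : 1 < #S)
  -- Now `E` is the star from `z` to `S`: exchange the leaf `a` for the centre `z`.
  refine ⟨insert z (S.erase a), ?_, isPrivateCover_star hz, fun w hw ↦ ⟨b, ?_, ?_⟩⟩
  · rw [← hcard, Finset.card_insert_of_notMem (fun h ↦ hz (Finset.mem_of_mem_erase h)),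
      Finset.card_erase_add_one ha]
  · simp [hb, hab.symm]
  · grind

end PrivateCover

section SteinerTree

variable {V : Type*} {G : SimpleGraph V} {S : Finset V} {T : G.Subgraph}

lemma verts_subset_of_adj_closed {H : G.Subgraph} (hH : H.Preconnected) {W : Set V} {u : V}
    (hu : u ∈ H.verts) (huW : u ∈ W) (hW : ∀ a ∈ W, ∀ b, H.Adj a b → b ∈ W) : H.verts ⊆ W := by
  intro v hv
  by_contra hvW
  obtain ⟨p⟩ := hH.coe ⟨u, hu⟩ ⟨v, hv⟩
  obtain ⟨d, -, hd, hd'⟩ := p.exists_boundary_dart (Subtype.val ⁻¹' W) huW hvW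
  exact hd' (hW _ hd _ d.adj)

lemma existsUnique_adj (hT : IsPendantSteinerTree S T) {s : V} (hs : s ∈ S) : ∃! y, T.Adj s y := by
  obtain ⟨y, hy⟩ := Set.ncard_eq_one.1 (hT.degree_eq_one s hs)
  exact ⟨y, hy.ge rfl, fun z hz ↦ hy.le hz⟩

lemma notMem_of_adj (hT : IsPendantSteinerTree S T) (hS : 3 ≤ #S) {s y : V} (hs : s ∈ S)
    (hsy : T.Adj s y) : y ∉ S := by
  classical
  intro hy
  have hclosed : ∀ a ∈ ({s, y} : Set V), ∀ b, T.Adj a b → b ∈ ({s, y} : Set V) := by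
    rintro a (rfl | rfl) b hab
    · exact Or.inr ((existsUnique_adj hT hs).unique hab hsy)
    · exact Or.inl ((existsUnique_adj hT hy).unique hab hsy.symm)
  have hverts := verts_subset_of_adj_closed ⟨hT.isTree.connected.preconnected⟩
    hsy.fst_mem (Set.mem_insert s {y}) hclosed
  have hsub : S ⊆ {s, y} := fun x hx ↦ by simpa using hverts (hT.subset_verts hx)
  have := (Finset.card_le_card hsub).trans Finset.card_le_two
  lia

lemma preconnected_induce_compl (hT : IsPendantSteinerTree S T) :
    (T.coe.induce {v | v.1 ∉ S}).Preconnected := by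
  refine hT.isTree.connected.preconnected.induce_of_degree_eq_one fun v hv a ha b hb ↦ ?_
  exact Subtype.ext ((existsUnique_adj hT (not_not.1 hv)).unique ha hb)

lemma exists_finset_edgeSet_card_eq (hT : IsPendantSteinerTree S T) (hS : 3 ≤ #S) :
    ∃ E : Finset G.edgeSet, #E = #S := by
  classical
  choose y hy using fun s : S ↦ (existsUnique_adj hT s.2).exists
  let pendantEdge : S → G.edgeSet := fun s ↦ ⟨s(s.1, y s), G.mem_edgeSet.2 (hy s).adj_sub⟩
  have hinj : Function.Injective pendantEdge := by
    intro s t hst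
    rcases Sym2.eq_iff.1 (congrArg Subtype.val hst) with ⟨h, -⟩ | ⟨-, h⟩
    · exact Subtype.ext h
    · exact absurd t.2 (h ▸ notMem_of_adj hT hS s.2 (hy s))
  exact ⟨Finset.univ.map ⟨pendantEdge, hinj⟩, by simp⟩

end SteinerTree

section HangLeaves

variable {V : Type*} {G : SimpleGraph V} {A L : Set V} {c : V → V}

/-- The subgraph of `G` induced on `A`, enlarged by the vertices `s ∈ L`, each of them joined to
`A` by the edge from `s` to `c s` only. When `A` and `L` are disjoint, its spanning trees have the
vertices of `L` as leaves. The edge from `s` to `c s` is present only if it is in `G` and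
`c s ∈ A`. -/
def hangLeaves (G : SimpleGraph V) (A L : Set V) (c : V → V) : G.Subgraph where
  verts := A ∪ L
  Adj u v := G.Adj u v ∧ (u ∈ A ∧ v ∈ A ∨ (u ∈ L ∧ v ∈ A ∧ v = c u) ∨ (v ∈ L ∧ u ∈ A ∧ u = c v))
  adj_sub h := h.1
  edge_vert := by
    rintro u v ⟨-, ⟨hu, -⟩ | ⟨hu, -⟩ | ⟨-, hu, -⟩⟩
    exacts [Or.inl hu, Or.inr hu, Or.inl hu]
  symm := ⟨fun _ _ h ↦ ⟨h.1.symm, by tauto⟩⟩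

lemma connected_hangLeaves (hA : (G.induce A).Connected)
    (hc : ∀ s ∈ L, c s ∈ A ∧ G.Adj s (c s)) : (hangLeaves G A L c).Connected := by
  let φ : G.induce A →g (hangLeaves G A L c).coe :=
    { toFun := fun a ↦ ⟨a, Or.inl a.2⟩
      map_rel' := fun {a b} hab ↦ ⟨hab, Or.inl ⟨a.2, b.2⟩⟩ }
  obtain ⟨a₀⟩ := hA.nonempty
  rw [Subgraph.connected_iff', connected_iff_exists_forall_reachable]
  refine ⟨φ a₀, ?_⟩
  rintro ⟨v, hv | hv⟩
  · exact (hA.preconnected a₀ ⟨v, hv⟩).map φ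
  · obtain ⟨hcA, hcv⟩ := hc v hv
    refine ((hA.preconnected a₀ ⟨c v, hcA⟩).map φ).trans (Adj.reachable ?_)
    exact ⟨hcv.symm, Or.inr (Or.inr ⟨hv, hcA, rfl⟩)⟩

lemma exists_isTree_le {H : G.Subgraph} (hH : H.Connected) :
    ∃ T ≤ H, T.verts = H.verts ∧ T.coe.IsTree := by
  obtain ⟨F, hFH, hF⟩ := hH.coe.exists_isTree_le
  let T : G.Subgraph :=
    { verts := H.verts
      Adj := fun u v ↦ ∃ (hu : u ∈ H.verts) (hv : v ∈ H.verts), F.Adj ⟨u, hu⟩ ⟨v, hv⟩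
      adj_sub := fun ⟨_, _, h⟩ ↦ (hFH h).adj_sub
      edge_vert := fun ⟨hu, _, _⟩ ↦ hu
      symm := ⟨fun _ _ ⟨hu, hv, h⟩ ↦ ⟨hv, hu, h.symm⟩⟩ }
  have hTF : T.coe = F := by
    ext u v
    exact ⟨fun ⟨_, _, h⟩ ↦ h, fun h ↦ ⟨u.2, v.2, h⟩⟩
  exact ⟨T, ⟨subset_rfl, fun _ _ ⟨_, _, h⟩ ↦ hFH h⟩, rfl, hTF ▸ hF⟩

lemma exists_isPendantSteinerTree {S : Finset V} (hA : (G.induce A).Connected)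
    (hAS : ∀ a ∈ A, a ∉ S) (hS : ∀ s ∈ S, ∃ a ∈ A, G.Adj s a) :
    ∃ T : G.Subgraph, IsPendantSteinerTree S T ∧ T.verts = A ∪ S ∧
      ∀ u v, T.Adj u v → u ∈ A ∨ v ∈ A := by
  choose! c hc using hS
  obtain ⟨T, hle, hverts, hT⟩ := exists_isTree_le (connected_hangLeaves hA hc)
  refine ⟨T, ⟨hT, ?_, fun s hs ↦ ?_⟩, hverts, fun u v huv ↦ ?_⟩
  · exact hverts ▸ Set.subset_union_right
  · have hnbr : ∀ v, T.Adj s v → v = c s := by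
      intro v hsv
      rcases (hle.2 hsv).2 with ⟨hsA, -⟩ | ⟨-, -, hv⟩ | ⟨-, hsA, -⟩
      exacts [absurd hs (hAS s hsA), hv, absurd hs (hAS s hsA)]
    have hsT : s ∈ T.verts := hverts ▸ Or.inr hs
    have hcT : c s ∈ T.verts := hverts ▸ Or.inl (hc s hs).1
    have : Nontrivial T.verts :=
      ⟨⟨s, hsT⟩, ⟨c s, hcT⟩, fun h ↦ (hc s hs).2.ne (congrArg Subtype.val h)⟩
    obtain ⟨w, hw⟩ := Subgraph.Preconnected.exists_adj_of_nontrivial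
      ⟨hT.connected.preconnected⟩ ⟨s, hsT⟩
    exact Set.ncard_eq_one.2 ⟨c s, Set.eq_singleton_iff_unique_mem.2 ⟨hnbr w hw ▸ hw, hnbr⟩⟩
  · rcases (hle.2 huv).2 with ⟨hu, -⟩ | ⟨-, hv, -⟩ | ⟨-, hu, -⟩
    exacts [Or.inl hu, Or.inr hv, Or.inl hu]

end HangLeaves

section Connectivity

variable {V : Type*} {G : SimpleGraph V} {S : Finset V}

lemma pendantTreeConnectivity_card_le (S : Finset V) :
    G.pendantTreeConnectivity #S ≤ G.pendantTreeLocalConnectivity S :=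
  Nat.sInf_le ⟨S, rfl, rfl⟩

lemma pendantTreeEdgeConnectivity_card_le (S : Finset V) :
    G.pendantTreeEdgeConnectivity #S ≤ G.pendantTreeLocalEdgeConnectivity S :=
  Nat.sInf_le ⟨S, rfl, rfl⟩

lemma exists_isPendantSteinerTree_of_edgeConnectivity_pos {k : ℕ}
    (hk : 0 < G.pendantTreeEdgeConnectivity k) :
    ∃ S : Finset V, #S = k ∧ ∃ T : G.Subgraph, IsPendantSteinerTree S T := by
  obtain ⟨_, S, hS, -⟩ := Nat.nonempty_of_pos_sInf hk
  refine ⟨S, hS, ?_⟩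
  by_contra! hnone
  have hzero : G.pendantTreeLocalEdgeConnectivity S ≤ 0 := by
    refine csSup_le' ?_
    rintro m ⟨F, rfl, hF, -⟩
    exact (Finset.card_eq_zero.2 (Finset.eq_empty_of_forall_notMem fun T hT ↦
      hnone T (hF T hT))).le
  exact hk.not_ge (hS ▸ (pendantTreeEdgeConnectivity_card_le S).trans hzero)

variable [Finite V]

lemma bddAbove_card_subgraphs (P : Finset G.Subgraph → Prop) :
    BddAbove {m | ∃ F : Finset G.Subgraph, #F = m ∧ P F} := by
  have := Fintype.ofFinite G.Subgraph
  refine ⟨Fintype.card G.Subgraph, ?_⟩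
  rintro m ⟨F, rfl, -⟩
  exact F.card_le_univ

lemma pendantTreeLocalConnectivity_le_localEdgeConnectivity (S : Finset V) :
    G.pendantTreeLocalConnectivity S ≤ G.pendantTreeLocalEdgeConnectivity S := by
  refine csSup_le_csSup' (bddAbove_card_subgraphs _) ?_
  rintro m ⟨F, hF, hT, hd⟩
  exact ⟨F, hF, hT, hd.mono' fun _ _ h ↦ h.1⟩

lemma pendantTreeConnectivity_le_edgeConnectivity (G : SimpleGraph V) (k : ℕ) :
    G.pendantTreeConnectivity k ≤ G.pendantTreeEdgeConnectivity k := by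
  rcases Nat.eq_zero_or_pos (G.pendantTreeConnectivity k) with h | h
  · exact h ▸ Nat.zero_le _
  obtain ⟨_, S₀, hS₀, -⟩ := Nat.nonempty_of_pos_sInf h
  refine le_csInf ⟨_, S₀, hS₀, rfl⟩ ?_
  rintro _ ⟨S, rfl, rfl⟩
  exact (pendantTreeConnectivity_card_le S).trans
    (pendantTreeLocalConnectivity_le_localEdgeConnectivity S)

lemma card_le_pendantTreeLocalConnectivity {ι : Type*} [Fintype ι] (A : ι → Set V)
    (hdisj : Pairwise fun i j ↦ Disjoint (A i) (A j)) (hA : ∀ i, (G.induce (A i)).Connected)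
    (hAS : ∀ i, ∀ a ∈ A i, a ∉ S) (hS : ∀ i, ∀ s ∈ S, ∃ a ∈ A i, G.Adj s a) :
    Fintype.card ι ≤ G.pendantTreeLocalConnectivity S := by
  classical
  choose T hT hverts hadj using fun i ↦ exists_isPendantSteinerTree (hA i) (hAS i) (hS i)
  have hnotMem : ∀ i j, i ≠ j → ∀ v ∈ A i, v ∉ (T j).verts := by
    intro i j hij v hv hvT
    rcases hverts j ▸ hvT with hvA | hvS
    · exact Set.disjoint_left.1 (hdisj hij) hv hvA
    · exact hAS i v hv hvS
  have hinj : Function.Injective T := by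
    intro i j hij
    by_contra hne
    obtain ⟨a, ha⟩ := (hA i).nonempty
    exact hnotMem i j hne a ha (hij ▸ hverts i ▸ Or.inl ha)
  have hint : Pairwise fun i j ↦ InternallyDisjoint S (T i) (T j) := by
    intro i j hij
    refine ⟨Set.eq_empty_iff_forall_notMem.2 fun e ↦ ?_, Set.Subset.antisymm ?_ ?_⟩
    · induction e with | _ u v
      rintro ⟨hi : (T i).Adj u v, hj : (T j).Adj u v⟩
      rcases hadj i u v hi with h | h
      · exact hnotMem i j hij u h hj.fst_mem
      · exact hnotMem i j hij v h hj.snd_mem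
    · rintro v ⟨hi, hj⟩
      exact (hverts i ▸ hi).resolve_left fun h ↦ hnotMem i j hij v h hj
    · exact Set.subset_inter (hT i).subset_verts (hT j).subset_verts
  refine le_csSup (bddAbove_card_subgraphs _) ⟨Finset.univ.map ⟨T, hinj⟩, by simp, ?_, ?_⟩
  · simpa using hT
  · simpa [Set.Pairwise, Pairwise, hinj.eq_iff] using hint

end Connectivity

section LineGraph

variable {V : Type*} {G : SimpleGraph V} {S : Finset V} {T : G.Subgraph}

lemma preconnected_induce_lineGraph {W : Type*} {H : SimpleGraph W} (hH : H.Preconnected)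
    (φ : H →g G) {A : Set G.edgeSet} (hφA : ∀ e, φ.mapEdgeSet e ∈ A)
    (hmeet : ∀ f ∈ A, ∃ w, φ w ∈ f.1) : (G.lineGraph.induce A).Preconnected := by
  have reachable_of_mem : ∀ (f g : A) (v : V), v ∈ f.1.1 → v ∈ g.1.1 →
      (G.lineGraph.induce A).Reachable f g := by
    intro f g v hf hg
    by_cases hfg : f = g
    · exact hfg ▸ Reachable.rfl
    · exact Adj.reachable ⟨fun h ↦ hfg (Subtype.ext h), v, hf, hg⟩
  have reachable_of_walk : ∀ {w w' : W}, H.Walk w w' → ∀ f g : A, φ w ∈ f.1.1 → φ w' ∈ g.1.1 →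
      (G.lineGraph.induce A).Reachable f g := by
    intro w w' p
    induction p with
    | nil => exact fun f g ↦ reachable_of_mem f g _
    | @cons u v w huv _ ih =>
      intro f g hf hg
      let e : A := ⟨φ.mapEdgeSet ⟨s(u, v), huv⟩, hφA _⟩
      exact (reachable_of_mem f e (φ u) hf (Sym2.mem_mk_left _ _)).trans
        (ih e g (Sym2.mem_mk_right _ _) hg)
  intro f g
  obtain ⟨w, hw⟩ := hmeet f f.2
  obtain ⟨w', hw'⟩ := hmeet g g.2
  obtain ⟨p⟩ := hH w w'
  exact reachable_of_walk p f g hw hw'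

variable {E : Finset (Sym2 V)}

lemma exists_adj_mk_notMem (hT : IsPendantSteinerTree S T) (hE : IsPrivateCover E S)
    (hstar : ∀ z ∉ S, ∃ x ∈ S, s(x, z) ∉ E) {y : V} (hyT : y ∈ T.verts) (hy : y ∉ S) :
    ∃ w, T.Adj y w ∧ s(y, w) ∉ E := by
  by_contra! hall
  have hmemS : ∀ w, T.Adj y w → w ∈ S := fun w hyw ↦
    of_not_not fun hw ↦ hE.mk_notMem hy hw (hall w hyw)
  have hclosed : ∀ a ∈ {w | w = y ∨ T.Adj y w}, ∀ b, T.Adj a b → b ∈ {w | w = y ∨ T.Adj y w} := by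
    rintro a (rfl | hya) b hab
    · exact Or.inr hab
    · exact Or.inl ((existsUnique_adj hT (hmemS a hya)).unique hab hya.symm)
  have hverts := verts_subset_of_adj_closed ⟨hT.isTree.connected.preconnected⟩ hyT
    (Or.inl rfl) hclosed
  obtain ⟨x, hxS, hx⟩ := hstar y hy
  rcases hverts (hT.subset_verts hxS) with rfl | hyx
  · exact hy hxS
  · exact hx (Sym2.eq_swap (a := y) ▸ hall x hyx)

lemma exists_lineGraph_adj (hT : IsPendantSteinerTree S T) (hS : 3 ≤ #S) (hE : IsPrivateCover E S)
    (hstar : ∀ z ∉ S, ∃ x ∈ S, s(x, z) ∉ E) {e : G.edgeSet} (he : e.1 ∈ E) :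
    ∃ f : G.edgeSet, f.1 ∈ T.edgeSet \ E ∧ G.lineGraph.Adj e f := by
  have adj_of_mem : ∀ v w, T.Adj v w → s(v, w) ∉ E → v ∈ e.1 →
      ∃ f : G.edgeSet, f.1 ∈ T.edgeSet \ E ∧ G.lineGraph.Adj e f := by
    intro v w hvw hvwE hve
    have hne : e ≠ ⟨s(v, w), hvw.adj_sub⟩ := fun h ↦ hvwE (by rwa [h] at he)
    exact ⟨⟨s(v, w), hvw.adj_sub⟩, ⟨hvw, hvwE⟩, hne, v, hve, Sym2.mem_mk_left v w⟩
  obtain ⟨x, hxe, hxS, hpriv⟩ := hE _ he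
  obtain ⟨y, hxy⟩ := (existsUnique_adj hT hxS).exists
  have hy := notMem_of_adj hT hS hxS hxy
  by_cases hxyE : s(x, y) ∈ E
  · obtain ⟨w, hyw, hywE⟩ := exists_adj_mk_notMem hT hE hstar hxy.snd_mem hy
    exact adj_of_mem y w hyw hywE (hpriv y hy hxyE ▸ Sym2.mem_mk_right x y)
  · exact adj_of_mem x y hxy hxyE hxe

lemma connected_induce_edgeSet_sdiff (hT : IsPendantSteinerTree S T) (hS : 3 ≤ #S)
    (hE : IsPrivateCover E S) (hstar : ∀ z ∉ S, ∃ x ∈ S, s(x, z) ∉ E) :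
    (G.lineGraph.induce {f | f.1 ∈ T.edgeSet \ E}).Connected := by
  have hne : Nonempty {f : G.edgeSet | f.1 ∈ T.edgeSet \ E} := by
    obtain ⟨s, hs⟩ := Finset.card_pos.1 (by lia : 0 < #S)
    obtain ⟨y, hsy⟩ := (existsUnique_adj hT hs).exists
    obtain ⟨w, hyw, hywE⟩ :=
      exists_adj_mk_notMem hT hE hstar hsy.snd_mem (notMem_of_adj hT hS hs hsy)
    exact ⟨⟨s(y, w), hyw.adj_sub⟩, hyw, hywE⟩
  refine ⟨preconnected_induce_lineGraph (preconnected_induce_compl hT)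
    (T.hom.comp (Embedding.induce _).toHom) ?_ ?_⟩
  · rintro ⟨e, he⟩
    induction e with | _ u v
    exact ⟨he, hE.mk_notMem u.2 v.2⟩
  · rintro ⟨f, hfG⟩ ⟨hf, -⟩
    induction f with | _ u v
    have huv : T.Adj u v := hf
    by_cases hu : u ∈ S
    · exact ⟨⟨⟨v, huv.snd_mem⟩, notMem_of_adj hT hS hu huv⟩, Sym2.mem_mk_right u v⟩
    · exact ⟨⟨⟨u, huv.fst_mem⟩, hu⟩, Sym2.mem_mk_left u v⟩

lemma pendantTreeLocalEdgeConnectivity_le_lineGraph [Finite V] {E : Finset G.edgeSet}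
    (hS : 3 ≤ #S) (hE : IsPrivateCover (E.map (.subtype _)) S)
    (hstar : ∀ z ∉ S, ∃ x ∈ S, s(x, z) ∉ E.map (.subtype _)) :
    G.pendantTreeLocalEdgeConnectivity S ≤ G.lineGraph.pendantTreeLocalConnectivity E := by
  refine csSup_le' ?_
  rintro m ⟨F, rfl, hF, hdisj⟩
  rw [← Fintype.card_coe]
  refine card_le_pendantTreeLocalConnectivity
    (fun T : F ↦ {f | f.1 ∈ T.1.edgeSet \ (E.map (.subtype _) : Finset (Sym2 V))}) ?_
    (fun T ↦ connected_induce_edgeSet_sdiff (hF T T.2) hS hE hstar) ?_ ?_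
  · intro T T' hne
    refine Set.disjoint_left.2 fun f hf hf' ↦ ?_
    exact (hdisj T.2 T'.2 (Subtype.coe_ne_coe.2 hne)).le ⟨hf.1, hf'.1⟩
  · exact fun T f hf hfE ↦ hf.2 (Finset.mem_map_of_mem _ hfE)
  · exact fun T e he ↦ exists_lineGraph_adj (hF T T.2) hS hE hstar (Finset.mem_map_of_mem _ he)

theorem pendantTreeEdgeConnectivity_le_lineGraph [Finite V] (G : SimpleGraph V) {k : ℕ}
    (hk : 3 ≤ k) : G.pendantTreeEdgeConnectivity k ≤ G.lineGraph.pendantTreeConnectivity k := by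
  rcases Nat.eq_zero_or_pos (G.pendantTreeEdgeConnectivity k) with h | h
  · exact h ▸ Nat.zero_le _
  obtain ⟨S₀, rfl, T, hT⟩ := exists_isPendantSteinerTree_of_edgeConnectivity_pos h
  obtain ⟨E₀, hE₀⟩ := exists_finset_edgeSet_card_eq hT hk
  refine le_csInf ⟨_, E₀, hE₀, rfl⟩ ?_
  rintro _ ⟨E, hE, rfl⟩
  have hcard : #(E.map (.subtype _) : Finset (Sym2 V)) = #S₀ := by rw [Finset.card_map, hE]
  obtain ⟨S, hS, hcover, hstar⟩ :=
    exists_isPrivateCover_card_eq (by lia : 2 ≤ #(E.map (.subtype _))) hcard.symm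
  rw [hcard] at hS
  rw [← hS] at hk ⊢
  exact (pendantTreeEdgeConnectivity_card_le S).trans
    (pendantTreeLocalEdgeConnectivity_le_lineGraph hk hcover hstar)

end LineGraph

end PendantTree

theorem mainTheorem1_general {V : Type*} [Finite V] (G : SimpleGraph V) {k : ℕ} (hk : 3 ≤ k) :
    G.pendantTreeEdgeConnectivity k ≤ G.lineGraph.pendantTreeConnectivity k ∧
    G.pendantTreeEdgeConnectivity k ≤ G.lineGraph.pendantTreeEdgeConnectivity k ∧
    G.pendantTreeConnectivity k ≤ G.lineGraph.lineGraph.pendantTreeConnectivity k := by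
  have hμτ := PendantTree.pendantTreeEdgeConnectivity_le_lineGraph G hk
  have hμμ := hμτ.trans (PendantTree.pendantTreeConnectivity_le_edgeConnectivity G.lineGraph k)
  refine ⟨hμτ, hμμ, ?_⟩
  calc G.pendantTreeConnectivity k
      ≤ G.pendantTreeEdgeConnectivity k :=
        PendantTree.pendantTreeConnectivity_le_edgeConnectivity G k
    _ ≤ G.lineGraph.pendantTreeEdgeConnectivity k := hμμ
    _ ≤ G.lineGraph.lineGraph.pendantTreeConnectivity k :=
        PendantTree.pendantTreeEdgeConnectivity_le_lineGraph G.lineGraph hk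

theorem mainTheorem1 {V : Type*} [Finite V] (G : SimpleGraph V) (hG : G.Connected) :
    G.pendantTreeEdgeConnectivity 3 ≤ G.lineGraph.pendantTreeConnectivity 3 ∧
    (1 / 12 : ℝ) * (G.pendantTreeEdgeConnectivity 3 : ℝ) - 1 / 2 ≤
      (G.lineGraph.pendantTreeEdgeConnectivity 3 : ℝ) ∧
    (1 / 4 : ℝ) * (G.pendantTreeConnectivity 3 : ℝ) - 2 / 3 ≤
      (G.lineGraph.lineGraph.pendantTreeConnectivity 3 : ℝ) := by
  obtain ⟨h₁, h₂, h₃⟩ := mainTheorem1_general G le_rfl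
  rify at h₂ h₃
  exact ⟨h₁, by linarith, by linarith⟩
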